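/- Let $n\ge 0$ and let $X,Y,Z$ be the Pauli matrices. For $R\subseteq\{1,\dots,n\}$ and integers $n_X,n_Y,n_Z\ge 0$ with $|R|+n_X+n_Y+n_Z=n$, let $S=S_{R,n_X,n_Y,n_Z}$ be the set of $n$-qubit Pauli strings that have the identity at every site of $R$ and contain exactly $n_X$ letters $X$, $n_Y$ letters $Y$ and $n_Z$ letters $Z$, and put $$B_S=\frac{1}{\sqrt{2^n|S|}}\sum_{P\in S}P .$$ Let $U$ be distributed according to the normalized Haar measure on $SU(2)$, let $V=U^{\otimes n}$, and let the global $SU(2)$ measurement channel be $$\mathcal M(\rho)=\mathbb E_{U\sim SU(2)}\sum_{b\in\{0,1\}^n}V^\dagger|b\rangle\langle b|V\;\langle b|V\rho V^\dagger|b\rangle$$ for every $2^n\times 2^n$ complex matrix $\rho$. For $S=S_{R,n_X,n_Y,n_Z}$ and $S'=S_{R',n'_X,n'_Y,n'_Z}$ let $K=\tfrac12(n_X+n_Y+n_Z+n'_X+n'_Y+n'_Z)$ and $$c_{S,S'}=\frac{2}{\sqrt{n_X!\,n_Y!\,n_Z!\,n'_X!\,n'_Y!\,n'_Z!}}\cdot\frac{(n_X+n'_X)!\,(n_Y+n'_Y)!\,(n_Z+n'_Z)!}{\left(\frac{n_X+n'_X}{2}\right)!\left(\frac{n_Y+n'_Y}{2}\right)!\left(\frac{n_Z+n'_Z}{2}\right)!}\cdot\frac{K!\,(K+1)!}{(2K+2)!}$$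 if (a) $n_\alpha+n'_\alpha$ is even for all $\alpha\in\{X,Y,Z\}$ and (b) $R=R'$, and $c_{S,S'}=0$ otherwise. Then, for every $\rho$, $$\mathcal M(\rho)=\sum_{S,S'}c_{S,S'}\,\mathrm{tr}(B_{S'}\rho)\,B_S ,$$ where $S,S'$ run over all such sets. Moreover, $\mathrm{tr}\big(B_S^\dagger\,\mathcal M(B_{S'})\big)=c_{S,S'}$ for all $S,S'$; in particular $\mathcal M$ is block-diagonal in the $B_S$ basis: $\mathrm{tr}\big(B_S^\dagger\,\mathcal M(B_{S'})\big)=0$ whenever $R\ne R'$ or some $n_\alpha+n'_\alpha$ is odd. -/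

import Mathlib

open MeasureTheory Matrix
open scoped Nat

/-! ### The group `SU(2)` and its Haar probability measure -/

/-- The group `SU(2)` of unitary `2 × 2` complex matrices of determinant one. -/
abbrev SU2 : Type := Matrix.specialUnitaryGroup (Fin 2) ℂ

theorem SU2.coe_inv (U : SU2) : ((U⁻¹ : SU2) : Matrix (Fin 2) (Fin 2) ℂ) =
    star (U : Matrix (Fin 2) (Fin 2) ℂ) := rfl

instance SU2.instIsTopologicalGroup : IsTopologicalGroup SU2 where
  continuous_mul := by
    refine Continuous.subtype_mk ?_ _
    exact (continuous_subtype_val.comp continuous_fst).mul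
      (continuous_subtype_val.comp continuous_snd)
  continuous_inv := by
    refine continuous_induced_rng.2 ?_
    exact continuous_star.comp continuous_subtype_val

theorem SU2.isCompact_carrier :
    IsCompact (Matrix.specialUnitaryGroup (Fin 2) ℂ : Set (Matrix (Fin 2) (Fin 2) ℂ)) := by
  have hK : IsCompact (Set.pi Set.univ (fun _ : Fin 2 => Set.pi Set.univ
      (fun _ : Fin 2 => Metric.closedBall (0 : ℂ) 1))) :=
    isCompact_univ_pi fun _ => isCompact_univ_pi fun _ => isCompact_closedBall _ _
  refine IsCompact.of_isClosed_subset hK ?_ ?_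
  · have : (Matrix.specialUnitaryGroup (Fin 2) ℂ : Set (Matrix (Fin 2) (Fin 2) ℂ)) =
        {A | A * star A = 1} ∩ {A | A.det = 1} := by
      ext A
      simp [Matrix.mem_specialUnitaryGroup_iff, Matrix.mem_unitaryGroup_iff]
    rw [this]
    exact (isClosed_eq (continuous_id.mul continuous_star) continuous_const).inter
      (isClosed_eq (Continuous.matrix_det continuous_id) continuous_const)
  · intro A hA i _ j _
    have h := entry_norm_bound_of_unitary (Matrix.specialUnitaryGroup_le_unitaryGroup hA) i j
    simpa using h

instance SU2.instCompactSpace : CompactSpace SU2 :=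
  isCompact_iff_compactSpace.1 SU2.isCompact_carrier

noncomputable instance SU2.instMeasurableSpace : MeasurableSpace SU2 := borel SU2

instance SU2.instBorelSpace : BorelSpace SU2 := ⟨rfl⟩

/-- The uniform distribution on `SU(2)`: the Haar measure of total mass one. -/
noncomputable def haarSU2 : Measure SU2 := Measure.haarMeasure ⊤

instance haarSU2.instIsProbabilityMeasure : IsProbabilityMeasure haarSU2 :=
  ⟨Measure.haarMeasure_self (K₀ := (⊤ : TopologicalSpace.PositiveCompacts SU2))⟩

/-! ### Operators on `n` qubits -/

/-- Operators on `(ℂ²)^{⊗ n}`, as matrices in the computational basis `|b⟩`, `b ∈ {0,1}ⁿ`. -/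
abbrev QubitOp (n : ℕ) : Type := Matrix (Fin n → Fin 2) (Fin n → Fin 2) ℂ

/-- The tensor product `A 0 ⊗ A 1 ⊗ ⋯ ⊗ A (n - 1)` of one-qubit operators. -/
noncomputable def tensorOp {n : ℕ} (A : Fin n → Matrix (Fin 2) (Fin 2) ℂ) : QubitOp n :=
  Matrix.of fun b b' => ∏ k, A k (b k) (b' k)

/-- Labels of the four one-qubit Pauli operators. -/
inductive Pauli : Type
  | I | X | Y | Z
  deriving DecidableEq

instance Pauli.instFintype : Fintype Pauli :=
  ⟨{.I, .X, .Y, .Z}, fun P => by cases P <;> decide⟩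

/-- The one-qubit Pauli matrices. -/
noncomputable def Pauli.toMatrix : Pauli → Matrix (Fin 2) (Fin 2) ℂ
  | .I => 1
  | .X => !![0, 1; 1, 0]
  | .Y => !![0, -Complex.I; Complex.I, 0]
  | .Z => !![1, 0; 0, -1]

/-- The `n`-qubit Pauli string with label `P k` at site `k`. -/
noncomputable def pauliString {n : ℕ} (P : Fin n → Pauli) : QubitOp n :=
  tensorOp fun k => (P k).toMatrix

/-! ### The measurement channel -/

/-- The operator `∑_b V†|b⟩⟨b|V ⟨b|V A V†|b⟩`. -/
noncomputable def readout {n : ℕ} (V A : QubitOp n) : QubitOp n :=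
  ∑ b : Fin n → Fin 2, (V * A * Vᴴ) b b • (Vᴴ * Matrix.single b b (1 : ℂ) * V)

/-- The measurement channel `A ↦ 𝔼_V ∑_b V†|b⟩⟨b|V ⟨b|V A V†|b⟩` of a random operator `V` on
`n` qubits, where the expectation of a random matrix is taken entry by entry. -/
noncomputable def measurementChannel {Ω : Type*} [MeasurableSpace Ω] {n : ℕ} (μ : Measure Ω)
    (V : Ω → QubitOp n) (A : QubitOp n) : QubitOp n :=
  Matrix.of fun i j => ∫ ω, readout (V ω) A i j ∂μ

/-- The unitary `U^{⊗ n}`, the same rotation `U` applied to each of the `n` qubits. -/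
noncomputable def globalRotation (n : ℕ) (U : SU2) : QubitOp n :=
  tensorOp fun _ => (U : Matrix (Fin 2) (Fin 2) ℂ)

/-- The global `SU(2)` measurement channel: `V = U^{⊗ n}` with `U` uniform on `SU(2)`. -/
noncomputable def globalSU2Channel (n : ℕ) (A : QubitOp n) : QubitOp n :=
  measurementChannel haarSU2 (globalRotation n) A

theorem continuous_globalRotation (n : ℕ) : Continuous (globalRotation n) := by
  refine continuous_matrix fun b b' => ?_
  have h : Continuous fun U : SU2 =>
      ∏ k : Fin n, (U : Matrix (Fin 2) (Fin 2) ℂ) (b k) (b' k) :=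
    continuous_finsetProd _ fun k _ => Continuous.matrix_elem continuous_subtype_val _ _
  exact h

/-- The expectations in the definition of `globalSU2Channel` are integrals of integrable
functions. -/
theorem globalSU2Channel_integrable (n : ℕ) (A : QubitOp n) (i j : Fin n → Fin 2) :
    Integrable (fun U : SU2 => readout (globalRotation n U) A i j) haarSU2 := by
  have hV := continuous_globalRotation n
  have hc : Continuous (fun U : SU2 => readout (globalRotation n U) A) := by
    refine continuous_finsetSum _ fun b _ => ?_
    exact (((hV.matrix_mul continuous_const).matrix_mul hV.matrix_conjTranspose).matrix_elem
      b b).smul ((hV.matrix_conjTranspose.matrix_mul continuous_const).matrix_mul hV)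
  exact (hc.matrix_elem i j).integrable_of_hasCompactSupport
    (HasCompactSupport.of_compactSpace _)

/-! ### Fixed-identity permutation-invariant sets -/

/-- The parameters `(R, n_X, n_Y, n_Z)` of a fixed-identity permutation-invariant set
`S_{R, n_X, n_Y, n_Z}` of `n`-qubit Pauli strings. -/
@[ext]
structure FixedIdSet (n : ℕ) : Type where
  /-- the set of sites that carry the identity -/
  R : Finset (Fin n)
  /-- the number of sites that carry `X` -/
  nX : ℕ
  /-- the number of sites that carry `Y` -/
  nY : ℕ
  /-- the number of sites that carry `Z` -/
  nZ : ℕ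
  card_eq : R.card + nX + nY + nZ = n

noncomputable instance FixedIdSet.instFintype (n : ℕ) : Fintype (FixedIdSet n) :=
  Fintype.ofInjective
    (fun S : FixedIdSet n => (S.R, (⟨S.nX, by have := S.card_eq; omega⟩ : Fin (n + 1)),
      (⟨S.nY, by have := S.card_eq; omega⟩ : Fin (n + 1)),
      (⟨S.nZ, by have := S.card_eq; omega⟩ : Fin (n + 1))))
    (by
      intro S T h
      simp only [Prod.mk.injEq, Fin.mk.injEq] at h
      exact FixedIdSet.ext h.1 h.2.1 h.2.2.1 h.2.2.2)

/-- The Pauli strings in `S_{R, n_X, n_Y, n_Z}`: the identity at every site of `R`, and exactly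
`n_X` letters `X`, `n_Y` letters `Y` and `n_Z` letters `Z`. -/
def FixedIdSet.strings {n : ℕ} (S : FixedIdSet n) : Finset (Fin n → Pauli) :=
  {P : Fin n → Pauli | (∀ i ∈ S.R, P i = Pauli.I) ∧
    (Finset.univ.filter fun i => P i = Pauli.X).card = S.nX ∧
    (Finset.univ.filter fun i => P i = Pauli.Y).card = S.nY ∧
    (Finset.univ.filter fun i => P i = Pauli.Z).card = S.nZ}

/-- The operator `B_S = (2ⁿ |S|)^{-1/2} ∑_{P ∈ S} P`. -/
noncomputable def FixedIdSet.B {n : ℕ} (S : FixedIdSet n) : QubitOp n :=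
  ((1 / Real.sqrt (2 ^ n * (S.strings.card : ℝ)) : ℝ) : ℂ) • ∑ P ∈ S.strings, pauliString P

/-! ### The coefficients -/

/-- Condition (a) `n_α + n'_α` is even for each `α ∈ {X, Y, Z}`, and condition (b) `R = R'`. -/
def FixedIdSet.Compatible {n : ℕ} (S S' : FixedIdSet n) : Prop :=
  (Even (S.nX + S'.nX) ∧ Even (S.nY + S'.nY) ∧ Even (S.nZ + S'.nZ)) ∧ S.R = S'.R

/-- `K = (n_X + n_Y + n_Z + n'_X + n'_Y + n'_Z) / 2`; the division is exact for compatible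
`S`, `S'`. -/
def FixedIdSet.halfWeight {n : ℕ} (S S' : FixedIdSet n) : ℕ :=
  (S.nX + S.nY + S.nZ + S'.nX + S'.nY + S'.nZ) / 2

open Classical in
/-- The coefficient `c_{S,S'}`. The halves are taken in `ℕ`, which is exact in the branch where
they occur. -/
noncomputable def FixedIdSet.coeff {n : ℕ} (S S' : FixedIdSet n) : ℝ :=
  if S.Compatible S' then
    2 * (1 / Real.sqrt ((S.nX ! : ℝ) * (S.nY ! : ℝ) * (S.nZ ! : ℝ) *
        (S'.nX ! : ℝ) * (S'.nY ! : ℝ) * (S'.nZ ! : ℝ))) *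
      ((((S.nX + S'.nX)! : ℝ) * ((S.nY + S'.nY)! : ℝ) * ((S.nZ + S'.nZ)! : ℝ)) /
        ((((S.nX + S'.nX) / 2)! : ℝ) * (((S.nY + S'.nY) / 2)! : ℝ) *
          (((S.nZ + S'.nZ) / 2)! : ℝ))) *
      ((((S.halfWeight S')! : ℝ) * ((S.halfWeight S' + 1)! : ℝ)) /
        ((2 * S.halfWeight S' + 2)! : ℝ))
  else 0

/-!
Write `v = (x, y, z)` for the Bloch vector of `U`, that is `Uᴴ Z U = x X + y Y + z Z`. The rotated
outcome projector `Vᴴ|b⟩⟨b|V` is the tensor product of the `(1 ± v · σ) / 2`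
(`SU2.conj_single`), so its coefficient at a Pauli string is, up to signs and the factor `2⁻ⁿ`, the
monomial in `v` that counts the letters of the string. The sum over the outcomes `b` runs over all
sign patterns, and kills the product of the coefficients of two strings unless they have the
identity at the same sites (`readout_globalRotation`). The coefficients that are left depend only on
the type `(R, n_X, n_Y, n_Z)` of each string, so the strings of one type recombine into `B_S`, and
`c_{S,S'} = √(|S| |S'|) 𝔼[x^(n_X + n'_X) y^(n_Y + n'_Y) z^(n_Z + n'_Z)]` when `R = R'`. Here `|S|`
is a multinomial coefficient (`FixedIdSet.card_strings_mul`).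

The moments of `v` follow from the right invariance of the Haar measure. Right multiplication by a
one-parameter subgroup rotates `v` about an axis; differentiating the invariance of a moment along
the rotation gives `b 𝔼[x^(a+1) y^(b-1) z^c] = a 𝔼[x^(a-1) y^(b+1) z^c]`
(`integral_rotation_generator`), and likewise for `x` and `z`. With `x² + y² + z² = 1` these
relations force `𝔼[x^(a+2) y^b z^c] = (a + 1) / (a + b + c + 3) 𝔼[x^a y^b z^c]` and the vanishing of
all moments with an odd exponent, hence determine every moment (`IsSphereMoment.even_eq`).

The `B_S` are orthonormal for the Hilbert–Schmidt inner product (`FixedIdSet.trace_B_mul`), because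
the Pauli strings are orthogonal; so the matrix entries of the channel can be read off.
-/

/-! ### Invariance of the Haar measure of `SU(2)` -/

instance haarSU2.instIsHaarMeasure : haarSU2.IsHaarMeasure :=
  inferInstanceAs (Measure.haarMeasure ⊤).IsHaarMeasure

/-- `SU(2)` is compact, hence unimodular: its Haar measure is also right invariant. -/
instance haarSU2.instIsMulRightInvariant : haarSU2.IsMulRightInvariant := by
  refine ⟨fun g => ?_⟩
  have hm : Measurable fun U : SU2 => U * g := (continuous_mul_const g).measurable
  have : IsProbabilityMeasure (Measure.map (· * g) haarSU2) :=
    Measure.isProbabilityMeasure_map hm.aemeasurable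
  have : (Measure.map (· * g) haarSU2).IsHaarMeasure :=
    Measure.isHaarMeasure_map_mul_right haarSU2 g
  exact Measure.isHaarMeasure_eq_of_isProbabilityMeasure _ _

/-! ### Moments of a rotation-invariant random vector -/

/-- If the law of `(x, y)`, weighted by `g`, is invariant under plane rotations, then the integral
of the rotation generator applied to the monomial `x ^ a * y ^ b` vanishes. -/
theorem integral_rotation_generator {Ω : Type*} [MeasurableSpace Ω] {μ : Measure Ω}
    [IsProbabilityMeasure μ] {x y g : Ω → ℝ} (hx : Measurable x) (hy : Measurable y)
    (hg : Measurable g) (hxy : ∀ ω, x ω ^ 2 + y ω ^ 2 ≤ 1) (hg1 : ∀ ω, |g ω| ≤ 1) (a b : ℕ)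
    (hinv : ∀ θ : ℝ, ∫ ω, (Real.cos θ * x ω + Real.sin θ * y ω) ^ a *
        (Real.cos θ * y ω - Real.sin θ * x ω) ^ b * g ω ∂μ = ∫ ω, x ω ^ a * y ω ^ b * g ω ∂μ) :
    (b : ℝ) * ∫ ω, x ω ^ (a + 1) * y ω ^ (b - 1) * g ω ∂μ =
      (a : ℝ) * ∫ ω, x ω ^ (a - 1) * y ω ^ (b + 1) * g ω ∂μ := by
  set u : ℝ → Ω → ℝ := fun θ ω => Real.cos θ * x ω + Real.sin θ * y ω with hu
  set w : ℝ → Ω → ℝ := fun θ ω => Real.cos θ * y ω - Real.sin θ * x ω with hw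
  have huw : ∀ θ ω, u θ ω ^ 2 + w θ ω ^ 2 ≤ 1 := by
    intro θ ω
    have h := hxy ω
    have h2 := Real.sin_sq_add_cos_sq θ
    have : u θ ω ^ 2 + w θ ω ^ 2 = x ω ^ 2 + y ω ^ 2 := by
      simp only [hu, hw]
      linear_combination (x ω ^ 2 + y ω ^ 2) * h2
    linarith
  have hu1 : ∀ θ ω, |u θ ω| ≤ 1 := fun θ ω =>
    abs_le_one_iff_mul_self_le_one.2 (by nlinarith [huw θ ω, sq_nonneg (w θ ω)])
  have hw1 : ∀ θ ω, |w θ ω| ≤ 1 := fun θ ω =>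
    abs_le_one_iff_mul_self_le_one.2 (by nlinarith [huw θ ω, sq_nonneg (u θ ω)])
  have hmu : ∀ θ, Measurable (u θ) := fun θ => by simp only [hu]; fun_prop
  have hmw : ∀ θ, Measurable (w θ) := fun θ => by simp only [hw]; fun_prop
  have hb : ∀ θ ω (i j : ℕ), |u θ ω ^ i * w θ ω ^ j * g ω| ≤ 1 := by
    intro θ ω i j
    rw [abs_mul, abs_mul, abs_pow, abs_pow]
    have h1 := pow_le_one₀ (n := i) (abs_nonneg _) (hu1 θ ω)
    have h2 := pow_le_one₀ (n := j) (abs_nonneg _) (hw1 θ ω)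
    exact mul_le_one₀ (mul_le_one₀ h1 (by positivity) h2) (abs_nonneg _) (hg1 ω)
  have hint : ∀ θ (i j : ℕ), Integrable (fun ω => u θ ω ^ i * w θ ω ^ j * g ω) μ := by
    intro θ i j
    refine Integrable.of_bound (C := 1) ?_ (Filter.Eventually.of_forall fun ω => hb θ ω i j)
    exact ((((hmu θ).pow_const i).mul ((hmw θ).pow_const j)).mul hg).aestronglyMeasurable
  have hder := hasDerivAt_integral_of_dominated_loc_of_deriv_le (μ := μ) (x₀ := (0 : ℝ))
    (s := Set.univ) (F := fun θ ω => u θ ω ^ a * w θ ω ^ b * g ω)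
    (F' := fun θ ω => (a : ℝ) * (u θ ω ^ (a - 1) * w θ ω ^ (b + 1) * g ω) -
      (b : ℝ) * (u θ ω ^ (a + 1) * w θ ω ^ (b - 1) * g ω))
    (bound := fun _ => (a : ℝ) + b) Filter.univ_mem
    (Filter.Eventually.of_forall fun θ => (hint θ a b).aestronglyMeasurable) (hint 0 a b)
    (((hint 0 _ _).const_mul _).sub ((hint 0 _ _).const_mul _)).aestronglyMeasurable
    (Filter.Eventually.of_forall fun ω θ _ => ?_) (integrable_const _)
    (Filter.Eventually.of_forall fun ω θ _ => ?_)
  -- the integral is constant in `θ`, so its derivative at `θ = 0` vanishes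
  · have hconst : (fun θ => ∫ ω, u θ ω ^ a * w θ ω ^ b * g ω ∂μ) =
        fun _ => ∫ ω, x ω ^ a * y ω ^ b * g ω ∂μ := funext hinv
    have h0 := hder.2
    rw [hconst] at h0
    have h1 := h0.unique (hasDerivAt_const _ _)
    rw [integral_sub ((hint 0 _ _).const_mul _) ((hint 0 _ _).const_mul _),
      integral_const_mul, integral_const_mul] at h1
    simp only [hu, hw, Real.cos_zero, Real.sin_zero, one_mul, zero_mul, add_zero, sub_zero] at h1
    linarith
  · rw [Real.norm_eq_abs]
    refine (abs_sub _ _).trans ?_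
    rw [abs_mul (a : ℝ), abs_mul (b : ℝ), Nat.abs_cast, Nat.abs_cast]
    exact add_le_add (mul_le_of_le_one_right (by positivity) (hb _ _ _ _))
      (mul_le_of_le_one_right (by positivity) (hb _ _ _ _))
  · have h1 : HasDerivAt (fun θ => u θ ω) (w θ ω) θ := by
      have := ((Real.hasDerivAt_cos θ).mul_const (x ω)).add
        ((Real.hasDerivAt_sin θ).mul_const (y ω))
      refine this.congr_deriv ?_
      simp only [hw]; ring
    have h2 : HasDerivAt (fun θ => w θ ω) (-u θ ω) θ := by
      have := ((Real.hasDerivAt_cos θ).mul_const (y ω)).sub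
        ((Real.hasDerivAt_sin θ).mul_const (x ω))
      refine this.congr_deriv ?_
      simp only [hu]; ring
    refine (((h1.fun_pow a).mul (h2.fun_pow b)).mul_const (g ω)).congr_deriv ?_
    ring

/-- The moment `𝔼[x^{2a} y^{2b} z^{2c}]` of the uniform distribution on the unit sphere. -/
noncomputable def evenSphereMoment (a b c : ℕ) : ℝ :=
  2 * (((2 * a)! : ℝ) * (2 * b)! * (2 * c)! / ((a ! : ℝ) * b ! * c !)) *
    ((a + b + c + 1)! / (2 * (a + b + c) + 2)!)

theorem evenSphereMoment_rec_fst (a b c : ℕ) :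
    evenSphereMoment (a + 1) b c =
      (2 * a + 1) / (2 * a + 2 * b + 2 * c + 3) * evenSphereMoment a b c := by
  unfold evenSphereMoment
  have e1 : 2 * (a + 1) = 2 * a + 1 + 1 := by ring
  have e2 : a + 1 + b + c + 1 = (a + b + c + 1) + 1 := by ring
  have e3 : 2 * (a + 1 + b + c) + 2 = (2 * (a + b + c) + 2) + 1 + 1 := by ring
  rw [e1, e2, e3, Nat.factorial_succ (2 * a + 1), Nat.factorial_succ (2 * a), Nat.factorial_succ a,
    Nat.factorial_succ (a + b + c + 1), Nat.factorial_succ (2 * (a + b + c) + 2 + 1),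
    Nat.factorial_succ (2 * (a + b + c) + 2)]
  have := Nat.factorial_ne_zero a
  have := Nat.factorial_ne_zero b
  have := Nat.factorial_ne_zero c
  have := Nat.factorial_ne_zero (2 * (a + b + c) + 2)
  have h3 : (2 * a + 2 * b + 2 * c + 3 : ℝ) ≠ 0 := by positivity
  have h4 : (2 * (a + b + c) + 2 + 1 : ℝ) ≠ 0 := by positivity
  have h5 : (2 * (a + b + c) + 2 + 1 + 1 : ℝ) ≠ 0 := by positivity
  push_cast
  field_simp
  ring

theorem evenSphereMoment_swap (a b c : ℕ) : evenSphereMoment a b c = evenSphereMoment b a c := by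
  unfold evenSphereMoment
  rw [add_comm a b, mul_comm ((2 * a)! : ℝ), mul_comm (a ! : ℝ)]

theorem evenSphereMoment_rotate (a b c : ℕ) : evenSphereMoment a b c = evenSphereMoment c a b := by
  unfold evenSphereMoment
  rw [show c + a + b = a + b + c by ring]
  congr 3 <;> ring

/-- The relations between the moments of a probability distribution on the unit sphere that is
invariant under the rotations about two of the axes. -/
structure IsSphereMoment (m : ℕ → ℕ → ℕ → ℝ) : Prop where
  zero : m 0 0 0 = 1
  rot_xy : ∀ a b c : ℕ, (b : ℝ) * m (a + 1) (b - 1) c = a * m (a - 1) (b + 1) c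
  rot_xz : ∀ a b c : ℕ, (c : ℝ) * m (a + 1) b (c - 1) = a * m (a - 1) b (c + 1)
  sphere : ∀ a b c, m (a + 2) b c + m a (b + 2) c + m a b (c + 2) = m a b c

namespace IsSphereMoment

variable {m : ℕ → ℕ → ℕ → ℝ}

theorem rec_fst (h : IsSphereMoment m) (a b c : ℕ) :
    m (a + 2) b c = (a + 1) / (a + b + c + 3) * m a b c := by
  have h1 := h.rot_xy (a + 1) (b + 1) c
  have h2 := h.rot_xz (a + 1) b (c + 1)
  have h3 := h.sphere a b c
  push_cast at h1 h2
  have h4 : (a + b + c + 3 : ℝ) ≠ 0 := by positivity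
  field_simp
  rw [add_assoc a 1 1, add_assoc b 1 1] at h1
  rw [add_assoc a 1 1, add_assoc c 1 1] at h2
  norm_num at h1 h2
  linear_combination h1 + h2 + ((a : ℝ) + 1) * h3

theorem rec_snd (h : IsSphereMoment m) (a b c : ℕ) :
    m a (b + 2) c = (b + 1) / (a + b + c + 3) * m a b c := by
  have h1 := h.rot_xy (a + 1) (b + 1) c
  have h2 := h.rec_fst a b c
  push_cast at h1
  rw [add_assoc a 1 1, add_assoc b 1 1] at h1
  norm_num at h1
  have h5 : (a + 1 : ℝ) ≠ 0 := by positivity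
  rw [h2] at h1
  refine mul_left_cancel₀ h5 ?_
  rw [← h1]; ring

theorem rec_thd (h : IsSphereMoment m) (a b c : ℕ) :
    m a b (c + 2) = (c + 1) / (a + b + c + 3) * m a b c := by
  have h1 := h.rot_xz (a + 1) b (c + 1)
  have h2 := h.rec_fst a b c
  push_cast at h1
  rw [add_assoc a 1 1, add_assoc c 1 1] at h1
  norm_num at h1
  have h5 : (a + 1 : ℝ) ≠ 0 := by positivity
  rw [h2] at h1
  refine mul_left_cancel₀ h5 ?_
  rw [← h1]; ring

/-- Moments with an odd exponent vanish: the recursion reduces the exponent to `1`, and the moment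
with exponent `1` is the rotation generator applied to a monomial without that variable. -/
theorem odd_fst (h : IsSphereMoment m) {a : ℕ} (ha : Odd a) (b c : ℕ) : m a b c = 0 := by
  obtain ⟨k, rfl⟩ := ha
  induction k with
  | zero =>
    have := h.rot_xy 0 (b + 1) c
    simp only [Nat.cast_zero, zero_mul, Nat.add_sub_cancel, zero_add] at this
    exact (mul_eq_zero.1 this).resolve_left (by positivity)
  | succ k ih =>
    rw [show 2 * (k + 1) + 1 = (2 * k + 1) + 2 by ring, h.rec_fst, ih, mul_zero]

theorem odd_snd (h : IsSphereMoment m) (a : ℕ) {b : ℕ} (hb : Odd b) (c : ℕ) : m a b c = 0 := by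
  obtain ⟨k, rfl⟩ := hb
  induction k with
  | zero =>
    have := h.rot_xy (a + 1) 0 c
    simp only [Nat.cast_zero, zero_mul, Nat.add_sub_cancel, zero_add] at this
    exact (mul_eq_zero.1 this.symm).resolve_left (by positivity)
  | succ k ih =>
    rw [show 2 * (k + 1) + 1 = (2 * k + 1) + 2 by ring, h.rec_snd, ih, mul_zero]

theorem odd_thd (h : IsSphereMoment m) (a b : ℕ) {c : ℕ} (hc : Odd c) : m a b c = 0 := by
  obtain ⟨k, rfl⟩ := hc
  induction k with
  | zero =>
    have := h.rot_xz (a + 1) b 0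
    simp only [Nat.cast_zero, zero_mul, Nat.add_sub_cancel, zero_add] at this
    exact (mul_eq_zero.1 this.symm).resolve_left (by positivity)
  | succ k ih =>
    rw [show 2 * (k + 1) + 1 = (2 * k + 1) + 2 by ring, h.rec_thd, ih, mul_zero]

theorem even_eq (h : IsSphereMoment m) (a b c : ℕ) :
    m (2 * a) (2 * b) (2 * c) = evenSphereMoment a b c := by
  induction a with
  | succ a ih =>
    rw [evenSphereMoment_rec_fst, ← ih, mul_add_one, h.rec_fst]
    push_cast; rfl
  | zero =>
    induction b with
    | succ b ih =>
      rw [evenSphereMoment_swap, evenSphereMoment_rec_fst, evenSphereMoment_swap, ← ih,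
        mul_add_one, h.rec_snd]
      push_cast; ring
    | zero =>
      induction c with
      | succ c ih =>
        rw [evenSphereMoment_rotate, evenSphereMoment_rec_fst, ← evenSphereMoment_rotate, ← ih,
          mul_add_one, h.rec_thd]
        push_cast; ring
      | zero => simp [h.zero, evenSphereMoment]

end IsSphereMoment

/-! ### The Bloch vector of a rotation -/

namespace SU2

/-- The coordinates `(x, y, z)` of the Bloch vector of `U`, defined by
`Uᴴ * Z * U = x • X + y • Y + z • Z`, and the value `1` at the label `I`. They depend only on the
first row `(p, q)` of `U`: `x - i y = 2 (conj p) q` and `z = |p|² - |q|²`. -/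
noncomputable def bloch (U : SU2) : Pauli → ℝ
  | .I => 1
  | .X => 2 * ((U.1 0 0).re * (U.1 0 1).re + (U.1 0 0).im * (U.1 0 1).im)
  | .Y => 2 * ((U.1 0 0).im * (U.1 0 1).re - (U.1 0 0).re * (U.1 0 1).im)
  | .Z => (U.1 0 0).re ^ 2 + (U.1 0 0).im ^ 2 - ((U.1 0 1).re ^ 2 + (U.1 0 1).im ^ 2)

theorem continuous_bloch (P : Pauli) : Continuous fun U : SU2 => U.bloch P := by
  have h (i j : Fin 2) : Continuous fun U : SU2 => U.1 i j :=
    Continuous.matrix_elem continuous_subtype_val i j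
  have hr (i j : Fin 2) : Continuous fun U : SU2 => (U.1 i j).re :=
    Complex.continuous_re.comp (h i j)
  have hi (i j : Fin 2) : Continuous fun U : SU2 => (U.1 i j).im :=
    Complex.continuous_im.comp (h i j)
  cases P <;> simp only [bloch] <;> fun_prop

theorem row_norm_sq (U : SU2) :
    (U.1 0 0).re ^ 2 + (U.1 0 0).im ^ 2 + (U.1 0 1).re ^ 2 + (U.1 0 1).im ^ 2 = 1 := by
  have h : U.1 * star U.1 = 1 :=
    mem_unitaryGroup_iff.1 (mem_specialUnitaryGroup_iff.1 U.2).1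
  have h0 := congrArg Complex.re (congrFun (congrFun h 0) 0)
  simp [Matrix.mul_apply, Fin.sum_univ_two, star_eq_conjTranspose] at h0
  linarith

theorem bloch_sphere (U : SU2) : U.bloch .X ^ 2 + U.bloch .Y ^ 2 + U.bloch .Z ^ 2 = 1 := by
  have h := U.row_norm_sq
  simp only [bloch]
  linear_combination ((U.1 0 0).re ^ 2 + (U.1 0 0).im ^ 2 + (U.1 0 1).re ^ 2 +
    (U.1 0 1).im ^ 2 + 1) * h

/-- The element of `SU(2)` with first row `(α, β)`. -/
def ofRow (α β : ℂ) (h : Complex.normSq α + Complex.normSq β = 1) : SU2 :=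
  ⟨!![α, β; -star β, star α], by
    have h' : α * star α + β * star β = 1 := by
      simp only [Complex.star_def, Complex.mul_conj]
      exact_mod_cast h
    rw [mem_specialUnitaryGroup_iff, mem_unitaryGroup_iff]
    constructor
    · ext i j
      fin_cases i <;> fin_cases j <;>
        simp [Matrix.mul_apply, Fin.sum_univ_two, star_eq_conjTranspose] <;>
        simp only [Complex.star_def] at h' <;> first | ring1 | linear_combination h'
    · rw [det_fin_two_of]
      linear_combination h'⟩

theorem mul_ofRow_zero_zero (U : SU2) (α β : ℂ) (h) :
    (U * ofRow α β h).1 0 0 = U.1 0 0 * α - U.1 0 1 * star β := by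
  simp [ofRow, Matrix.mul_apply, Fin.sum_univ_two, sub_eq_add_neg]

theorem mul_ofRow_zero_one (U : SU2) (α β : ℂ) (h) :
    (U * ofRow α β h).1 0 1 = U.1 0 0 * β + U.1 0 1 * star α := by
  simp [ofRow, Matrix.mul_apply, Fin.sum_univ_two]

/-- The rotation by the angle `θ` about the `z`-axis. -/
noncomputable def rotZ (θ : ℝ) : SU2 :=
  ofRow ⟨Real.cos (θ / 2), -Real.sin (θ / 2)⟩ 0 (by
    have := Real.sin_sq_add_cos_sq (θ / 2)
    simp only [Complex.normSq_mk, map_zero]; linarith)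

/-- The rotation by the angle `θ` about the `y`-axis. -/
noncomputable def rotY (θ : ℝ) : SU2 :=
  ofRow (Real.cos (θ / 2) : ℝ) (Real.sin (θ / 2) : ℝ) (by
    have := Real.sin_sq_add_cos_sq (θ / 2)
    simp only [Complex.normSq_ofReal]; linarith)

theorem cos_eq_half (θ : ℝ) : Real.cos θ = Real.cos (θ / 2) ^ 2 - Real.sin (θ / 2) ^ 2 := by
  rw [← Real.cos_two_mul', mul_div_cancel₀ θ two_ne_zero]

theorem sin_eq_half (θ : ℝ) : Real.sin θ = 2 * Real.sin (θ / 2) * Real.cos (θ / 2) := by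
  rw [← Real.sin_two_mul, mul_div_cancel₀ θ two_ne_zero]

theorem bloch_mul_rotZ (U : SU2) (θ : ℝ) :
    (U * rotZ θ).bloch .X = Real.cos θ * U.bloch .X + Real.sin θ * U.bloch .Y ∧
    (U * rotZ θ).bloch .Y = Real.cos θ * U.bloch .Y - Real.sin θ * U.bloch .X ∧
    (U * rotZ θ).bloch .Z = U.bloch .Z := by
  have h := Real.sin_sq_add_cos_sq (θ / 2)
  rw [cos_eq_half θ, sin_eq_half θ]
  refine ⟨?_, ?_, ?_⟩ <;>
    simp only [bloch, rotZ, mul_ofRow_zero_zero, mul_ofRow_zero_one, star_zero, mul_zero, sub_zero,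
      zero_add, Complex.star_def, Complex.mul_re, Complex.mul_im, Complex.conj_re, Complex.conj_im]
  · ring
  · ring
  · linear_combination ((U.1 0 0).re ^ 2 + (U.1 0 0).im ^ 2 - (U.1 0 1).re ^ 2 -
      (U.1 0 1).im ^ 2) * h

theorem bloch_mul_rotY (U : SU2) (θ : ℝ) :
    (U * rotY θ).bloch .X = Real.cos θ * U.bloch .X + Real.sin θ * U.bloch .Z ∧
    (U * rotY θ).bloch .Z = Real.cos θ * U.bloch .Z - Real.sin θ * U.bloch .X ∧
    (U * rotY θ).bloch .Y = U.bloch .Y := by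
  have h := Real.sin_sq_add_cos_sq (θ / 2)
  rw [cos_eq_half θ, sin_eq_half θ]
  refine ⟨?_, ?_, ?_⟩ <;>
    simp only [bloch, rotY, mul_ofRow_zero_zero, mul_ofRow_zero_one, Complex.star_def,
      Complex.mul_re, Complex.mul_im, Complex.conj_ofReal, Complex.ofReal_re, Complex.ofReal_im,
      Complex.sub_re, Complex.sub_im, Complex.add_re, Complex.add_im]
  · ring
  · ring
  · linear_combination 2 * ((U.1 0 0).im * (U.1 0 1).re - (U.1 0 0).re * (U.1 0 1).im) * h

/-- The moment `𝔼[x^a y^b z^c]` of the Bloch vector of a Haar-random rotation. -/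
noncomputable def blochMoment (a b c : ℕ) : ℝ :=
  ∫ U : SU2, U.bloch .X ^ a * U.bloch .Y ^ b * U.bloch .Z ^ c ∂haarSU2

theorem abs_bloch_le_one (U : SU2) (P : Pauli) : |U.bloch P| ≤ 1 := by
  have h := U.bloch_sphere
  rw [abs_le_one_iff_mul_self_le_one]
  cases P
  · simp [bloch]
  all_goals nlinarith [sq_nonneg (U.bloch .X), sq_nonneg (U.bloch .Y), sq_nonneg (U.bloch .Z)]

theorem integrable_bloch_monomial (a b c : ℕ) :
    Integrable (fun U : SU2 => U.bloch .X ^ a * U.bloch .Y ^ b * U.bloch .Z ^ c) haarSU2 :=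
  ((((continuous_bloch .X).pow a).mul ((continuous_bloch .Y).pow b)).mul
    ((continuous_bloch .Z).pow c)).integrable_of_hasCompactSupport
      (HasCompactSupport.of_compactSpace _)

/-- The invariance of the Haar measure under right multiplication by `rotZ` and `rotY` gives the
relations in the planes `xy` and `xz`. -/
theorem isSphereMoment_blochMoment : IsSphereMoment blochMoment where
  zero := by simp [blochMoment]
  rot_xy a b c := by
    have hm (P : Pauli) := (continuous_bloch P).measurable
    refine integral_rotation_generator (hm .X) (hm .Y) ((hm .Z).pow_const c)
      (fun U => ?_) (fun U => ?_) a b fun θ => ?_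
    · nlinarith [U.bloch_sphere, sq_nonneg (U.bloch .Z)]
    · rw [abs_pow]; exact pow_le_one₀ (abs_nonneg _) (U.abs_bloch_le_one _)
    · refine Eq.trans ?_ (integral_mul_right_eq_self
        (fun U : SU2 => U.bloch .X ^ a * U.bloch .Y ^ b * U.bloch .Z ^ c) (rotZ θ))
      refine integral_congr_ae (Filter.Eventually.of_forall fun U => ?_)
      obtain ⟨h1, h2, h3⟩ := bloch_mul_rotZ U θ
      simp only [h1, h2, h3]
  rot_xz a b c := by
    have hm (P : Pauli) := (continuous_bloch P).measurable
    have key := integral_rotation_generator (μ := haarSU2) (hm .X) (hm .Z) ((hm .Y).pow_const b)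
      (fun U => ?_) (fun U => ?_) a c fun θ => ?_
    · simpa only [blochMoment, mul_right_comm _ (bloch _ Pauli.Y ^ b)] using key
    · nlinarith [U.bloch_sphere, sq_nonneg (U.bloch .Y)]
    · rw [abs_pow]; exact pow_le_one₀ (abs_nonneg _) (U.abs_bloch_le_one _)
    · refine Eq.trans ?_ (integral_mul_right_eq_self
        (fun U : SU2 => U.bloch .X ^ a * U.bloch .Z ^ c * U.bloch .Y ^ b) (rotY θ))
      refine integral_congr_ae (Filter.Eventually.of_forall fun U => ?_)
      obtain ⟨h1, h2, h3⟩ := bloch_mul_rotY U θ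
      simp only [h1, h2, h3]
  sphere a b c := by
    have h := integrable_bloch_monomial
    simp only [blochMoment]
    have h2 : Integrable (fun U : SU2 => U.bloch .X ^ (a + 2) * U.bloch .Y ^ b * U.bloch .Z ^ c +
        U.bloch .X ^ a * U.bloch .Y ^ (b + 2) * U.bloch .Z ^ c) haarSU2 := (h _ _ _).add (h _ _ _)
    rw [← integral_add (h _ _ _) (h _ _ _), ← integral_add h2 (h _ _ _)]
    refine integral_congr_ae (Filter.Eventually.of_forall fun U => ?_)
    linear_combination (U.bloch .X ^ a * U.bloch .Y ^ b * U.bloch .Z ^ c) * U.bloch_sphere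

end SU2

/-! ### Pauli strings -/

theorem tensorOp_mul {n : ℕ} (A B : Fin n → Matrix (Fin 2) (Fin 2) ℂ) :
    tensorOp A * tensorOp B = tensorOp fun k => A k * B k := by
  ext b b'
  simp only [tensorOp, Matrix.mul_apply, of_apply, ← Finset.prod_mul_distrib]
  exact (Fintype.prod_sum fun k c => A k (b k) c * B k c (b' k)).symm

theorem trace_tensorOp {n : ℕ} (A : Fin n → Matrix (Fin 2) (Fin 2) ℂ) :
    (tensorOp A).trace = ∏ k, (A k).trace := by
  simp only [Matrix.trace, diag_apply, tensorOp, of_apply]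
  exact (Fintype.prod_sum fun k c => A k c c).symm

theorem conjTranspose_tensorOp {n : ℕ} (A : Fin n → Matrix (Fin 2) (Fin 2) ℂ) :
    (tensorOp A)ᴴ = tensorOp fun k => (A k)ᴴ := by
  ext b b'
  simp [tensorOp, conjTranspose_apply]

theorem tensorOp_single {n : ℕ} (b : Fin n → Fin 2) :
    tensorOp (fun k => Matrix.single (b k) (b k) (1 : ℂ)) = Matrix.single b b 1 := by
  ext c c'
  simp only [tensorOp, of_apply, Matrix.single_apply, Finset.prod_ite_zero, Finset.prod_const_one,
    Finset.mem_univ, true_imp_iff, funext_iff, forall_and]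

/-- Multilinear expansion of a tensor product of one-qubit operators into Pauli strings. -/
theorem tensorOp_sum_pauli {n : ℕ} (c : Fin n → Pauli → ℂ) :
    tensorOp (fun k => ∑ P, c k P • P.toMatrix) =
      ∑ P : Fin n → Pauli, (∏ k, c k (P k)) • pauliString P := by
  ext b b'
  simp only [tensorOp, pauliString, of_apply, Matrix.sum_apply, Matrix.smul_apply, smul_eq_mul,
    ← Finset.prod_mul_distrib]
  exact Fintype.prod_sum fun k P => c k P * P.toMatrix (b k) (b' k)

namespace Pauli

theorem sum_univ {M : Type*} [AddCommMonoid M] (f : Pauli → M) :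
    ∑ P, f P = f .I + f .X + f .Y + f .Z := by
  rw [show (Finset.univ : Finset Pauli) = {.I, .X, .Y, .Z} from rfl]
  simp [Finset.sum_insert, add_assoc]

theorem isHermitian_toMatrix (P : Pauli) : P.toMatrixᴴ = P.toMatrix := by
  cases P <;> ext i j <;> fin_cases i <;> fin_cases j <;> simp [toMatrix]

theorem trace_toMatrix_mul (P Q : Pauli) :
    (P.toMatrix * Q.toMatrix).trace = if P = Q then 2 else 0 := by
  cases P <;> cases Q <;> simp [toMatrix, Matrix.trace_fin_two, Matrix.one_fin_two] <;> norm_num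

end Pauli

theorem isHermitian_pauliString {n : ℕ} (P : Fin n → Pauli) :
    (pauliString P)ᴴ = pauliString P := by
  simp only [pauliString, conjTranspose_tensorOp, Pauli.isHermitian_toMatrix]

theorem trace_pauliString_mul {n : ℕ} (P Q : Fin n → Pauli) :
    (pauliString P * pauliString Q).trace = if P = Q then 2 ^ n else 0 := by
  simp only [pauliString, tensorOp_mul, trace_tensorOp, Pauli.trace_toMatrix_mul,
    Finset.prod_ite_zero, Finset.prod_const, Finset.card_univ, Fintype.card_fin, Finset.mem_univ,
    true_imp_iff, funext_iff]

/-! ### The readout of a global rotation -/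

/-- The coefficient of the Pauli matrix `P` in the rotated projector `Uᴴ|β⟩⟨β|U`. -/
noncomputable def SU2.projCoeff (U : SU2) (β : Fin 2) (P : Pauli) : ℂ :=
  (if P = .I then 1 else (-1) ^ (β : ℕ)) * (U.bloch P : ℂ) / 2

/-- `Uᴴ|β⟩⟨β|U = (1 ± (x X + y Y + z Z)) / 2` with `(x, y, z)` the Bloch vector of `U`. -/
theorem SU2.conj_single (U : SU2) (β : Fin 2) :
    U.1ᴴ * Matrix.single β β 1 * U.1 = ∑ P, U.projCoeff β P • P.toMatrix := by
  have h0 : U.1ᴴ * Matrix.single 0 0 1 * U.1 = ∑ P, U.projCoeff 0 P • P.toMatrix := by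
    have h := U.row_norm_sq
    simp only [pow_two] at h
    rw [Pauli.sum_univ]
    ext i j
    fin_cases i <;> fin_cases j <;> apply Complex.ext <;>
      simp [Pauli.toMatrix, projCoeff, bloch, Matrix.mul_apply, Fin.sum_univ_two,
        Matrix.single_apply, Matrix.one_fin_two, pow_two] <;> linarith
  fin_cases β
  · exact h0
  -- the two projectors add up to the identity
  · have h1 : (Matrix.single 1 1 1 : Matrix (Fin 2) (Fin 2) ℂ) = 1 - Matrix.single 0 0 1 := by
      ext i j; fin_cases i <;> fin_cases j <;> simp
    have hU : U.1ᴴ * U.1 = 1 :=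
      mem_unitaryGroup_iff'.1 (mem_specialUnitaryGroup_iff.1 U.2).1
    have hI : (1 : Matrix (Fin 2) (Fin 2) ℂ) = (2 * U.projCoeff 0 .I) • Pauli.I.toMatrix := by
      simp [projCoeff, bloch, Pauli.toMatrix]
    have hs : U.projCoeff 1 .I = U.projCoeff 0 .I ∧ U.projCoeff 1 .X = - U.projCoeff 0 .X ∧
        U.projCoeff 1 .Y = - U.projCoeff 0 .Y ∧ U.projCoeff 1 .Z = - U.projCoeff 0 .Z := by
      simp [projCoeff, neg_div]
    change U.1ᴴ * Matrix.single 1 1 1 * U.1 = ∑ P, U.projCoeff 1 P • P.toMatrix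
    rw [h1, Matrix.mul_sub, Matrix.sub_mul, Matrix.mul_one, hU, h0, hI, Pauli.sum_univ,
      Pauli.sum_univ, hs.1, hs.2.1, hs.2.2.1, hs.2.2.2]
    module

/-- Summing over the outcome kills the cross terms between the identity and the other Paulis. -/
theorem SU2.sum_projCoeff_mul (U : SU2) (P Q : Pauli) :
    ∑ β, U.projCoeff β P * U.projCoeff β Q =
      if P = .I ↔ Q = .I then (U.bloch P * U.bloch Q : ℂ) / 2 else 0 := by
  rw [Fin.sum_univ_two]
  by_cases hP : P = .I <;> by_cases hQ : Q = .I <;> simp [projCoeff, hP, hQ] <;> ring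

theorem globalRotation_conj_single {n : ℕ} (U : SU2) (b : Fin n → Fin 2) :
    (globalRotation n U)ᴴ * Matrix.single b b 1 * globalRotation n U =
      ∑ P : Fin n → Pauli, (∏ k, U.projCoeff (b k) (P k)) • pauliString P := by
  rw [← tensorOp_sum_pauli, ← tensorOp_single, globalRotation, conjTranspose_tensorOp,
    tensorOp_mul, tensorOp_mul]
  congr 1
  exact funext fun k => U.conj_single (b k)

theorem Matrix.conj_apply_self_eq_trace {m : Type*} [Fintype m] [DecidableEq m]
    (V A : Matrix m m ℂ) (b : m) :
    (V * A * Vᴴ) b b = (Vᴴ * Matrix.single b b 1 * V * A).trace := by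
  have h : Vᴴ * Matrix.single b b 1 * V * A = Vᴴ * (Matrix.single b b 1 * (V * A)) := by
    simp only [Matrix.mul_assoc]
  rw [h, Matrix.trace_mul_comm, Matrix.mul_assoc (Matrix.single b b 1),
    Matrix.trace_single_mul, one_smul]

/-- The readout of `U^{⊗ n}` as a matrix in the Pauli basis. -/
theorem readout_globalRotation {n : ℕ} (U : SU2) (A : QubitOp n) :
    readout (globalRotation n U) A = ∑ P : Fin n → Pauli, ∑ Q : Fin n → Pauli,
      (if ∀ k, P k = .I ↔ Q k = .I then
        (((∏ k, U.bloch (P k)) * ∏ k, U.bloch (Q k) : ℝ) : ℂ) / 2 ^ n else 0) •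
      (pauliString Q * A).trace • pauliString P := by
  have hsum (P Q : Fin n → Pauli) :
      ∑ b : Fin n → Fin 2, (∏ k, U.projCoeff (b k) (P k)) * ∏ k, U.projCoeff (b k) (Q k) =
        if ∀ k, P k = .I ↔ Q k = .I then
          (((∏ k, U.bloch (P k)) * ∏ k, U.bloch (Q k) : ℝ) : ℂ) / 2 ^ n else 0 := by
    simp only [← Finset.prod_mul_distrib]
    rw [← Fintype.prod_sum fun k β => U.projCoeff β (P k) * U.projCoeff β (Q k)]
    simp only [SU2.sum_projCoeff_mul, Finset.prod_ite_zero, Finset.mem_univ, true_imp_iff,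
      Finset.prod_div_distrib, Finset.prod_const, Finset.card_univ, Fintype.card_fin]
    push_cast
    rfl
  have hb (b : Fin n → Fin 2) : (globalRotation n U * A * (globalRotation n U)ᴴ) b b •
      ((globalRotation n U)ᴴ * Matrix.single b b 1 * globalRotation n U) =
        ∑ P : Fin n → Pauli, ∑ Q : Fin n → Pauli,
          ((∏ k, U.projCoeff (b k) (P k)) * ∏ k, U.projCoeff (b k) (Q k)) •
            (pauliString Q * A).trace • pauliString P := by
    rw [Matrix.conj_apply_self_eq_trace, globalRotation_conj_single, Matrix.sum_mul,
      Matrix.trace_sum, Finset.smul_sum]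
    refine Finset.sum_congr rfl fun P _ => ?_
    rw [Finset.sum_smul]
    refine Finset.sum_congr rfl fun Q _ => ?_
    rw [Matrix.smul_mul, Matrix.trace_smul, smul_smul, smul_smul, smul_eq_mul]
    congr 1
    ring
  simp only [readout, hb]
  rw [Finset.sum_comm]
  refine Finset.sum_congr rfl fun P _ => ?_
  rw [Finset.sum_comm]
  refine Finset.sum_congr rfl fun Q _ => ?_
  rw [← Finset.sum_smul, hsum]

/-! ### Sorting Pauli strings by identity sites and letter counts -/

/-- The number of sites at which the Pauli string `P` carries the letter `α`. -/
def letterCount {n : ℕ} (P : Fin n → Pauli) (α : Pauli) : ℕ :=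
  (Finset.univ.filter fun i => P i = α).card

theorem sum_letterCount {n : ℕ} (P : Fin n → Pauli) :
    letterCount P .I + letterCount P .X + letterCount P .Y + letterCount P .Z = n := by
  rw [← Pauli.sum_univ (letterCount P)]
  have := Finset.card_eq_sum_card_fiberwise (f := P) (s := Finset.univ) (t := Finset.univ)
    (fun _ _ => Finset.mem_coe.2 (Finset.mem_univ _))
  rw [Finset.card_univ, Fintype.card_fin] at this
  exact this.symm

theorem prod_bloch_string {n : ℕ} (U : SU2) (P : Fin n → Pauli) :
    ∏ k, U.bloch (P k) = U.bloch .X ^ letterCount P .X * U.bloch .Y ^ letterCount P .Y *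
      U.bloch .Z ^ letterCount P .Z := by
  rw [← Finset.prod_fiberwise' Finset.univ P U.bloch,
    show (Finset.univ : Finset Pauli) = {.I, .X, .Y, .Z} from rfl]
  simp [Finset.prod_insert, letterCount, SU2.bloch, mul_assoc]

namespace FixedIdSet

variable {n : ℕ}

/-- The parameters of the fixed-identity permutation-invariant set that contains `P`. -/
def ofString (P : Fin n → Pauli) : FixedIdSet n where
  R := Finset.univ.filter fun i => P i = .I
  nX := letterCount P .X
  nY := letterCount P .Y
  nZ := letterCount P .Z
  card_eq := sum_letterCount P

theorem mem_strings_iff {S : FixedIdSet n} {P : Fin n → Pauli} :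
    P ∈ S.strings ↔ ofString P = S := by
  simp only [strings, Finset.mem_filter, Finset.mem_univ, true_and]
  constructor
  · rintro ⟨hR, hX, hY, hZ⟩
    refine FixedIdSet.ext ?_ hX hY hZ
    -- the letters `X`, `Y`, `Z` use up all the sites outside `S.R`
    refine (Finset.eq_of_subset_of_card_le (fun i hi => ?_) ?_).symm
    · simpa [ofString] using hR i hi
    · have h1 := sum_letterCount P
      have h2 := S.card_eq
      simp only [letterCount] at h1
      simp only [ofString]
      omega
  · rintro rfl
    exact ⟨fun i hi => (Finset.mem_filter.1 hi).2, rfl, rfl, rfl⟩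

theorem sum_strings {M : Type*} [AddCommMonoid M] (f : (Fin n → Pauli) → M) :
    ∑ P, f P = ∑ S : FixedIdSet n, ∑ P ∈ S.strings, f P := by
  classical
  rw [← Finset.sum_fiberwise Finset.univ ofString f]
  refine Finset.sum_congr rfl fun S _ => Finset.sum_congr ?_ fun _ _ => rfl
  ext P
  simp [mem_strings_iff]

/-- A string in `S` amounts to the choice of the sites of its letters `X` and `Y` outside `S.R`. -/
theorem card_strings_eq_choose (S : FixedIdSet n) :
    S.strings.card = (S.nX + S.nY + S.nZ).choose S.nX * (S.nY + S.nZ).choose S.nY := by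
  classical
  have hR : S.Rᶜ.card = S.nX + S.nY + S.nZ := by
    have := S.card_eq
    rw [Finset.card_compl, Fintype.card_fin]
    omega
  have hcard : (S.Rᶜ.powersetCard S.nX).sum (fun A => ((S.Rᶜ \ A).powersetCard S.nY).card) =
      (S.nX + S.nY + S.nZ).choose S.nX * (S.nY + S.nZ).choose S.nY := by
    rw [Finset.sum_congr rfl (g := fun _ => (S.nY + S.nZ).choose S.nY),
      Finset.sum_const, Finset.card_powersetCard, hR, smul_eq_mul]
    intro A hA
    obtain ⟨h1, h2⟩ := Finset.mem_powersetCard.1 hA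
    rw [Finset.card_powersetCard, Finset.card_sdiff_of_subset h1, hR, h2]
    congr 1
    omega
  rw [← hcard, ← Finset.card_sigma]
  refine Finset.card_bij' (fun P _ => ⟨Finset.univ.filter fun i => P i = .X,
      Finset.univ.filter fun i => P i = .Y⟩)
    (fun p _ k => if k ∈ S.R then .I else if k ∈ p.1 then .X else if k ∈ p.2 then .Y else .Z)
    ?_ ?_ ?_ ?_
  · intro P hP
    rw [mem_strings_iff] at hP
    subst hP
    simp only [Finset.mem_sigma, Finset.mem_powersetCard]
    refine ⟨⟨fun i hi => ?_, rfl⟩, fun i hi => ?_, rfl⟩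
    · simp_all [ofString]
    · simp_all [ofString]
  · rintro ⟨A, B⟩ hp
    simp only [Finset.mem_sigma, Finset.mem_powersetCard] at hp
    obtain ⟨⟨hA, hAc⟩, hB, hBc⟩ := hp
    have hA' : ∀ i ∈ A, i ∉ S.R := fun i hi => Finset.mem_compl.1 (hA hi)
    have hB' : ∀ i ∈ B, i ∉ S.R ∧ i ∉ A := fun i hi => by
      simpa using hB hi
    have hX : (Finset.univ.filter fun k => (if k ∈ S.R then Pauli.I else if k ∈ A then .X
        else if k ∈ B then .Y else .Z) = .X) = A := by
      ext k; simp only [Finset.mem_filter, Finset.mem_univ, true_and]; grind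
    have hY : (Finset.univ.filter fun k => (if k ∈ S.R then Pauli.I else if k ∈ A then .X
        else if k ∈ B then .Y else .Z) = .Y) = B := by
      ext k; simp only [Finset.mem_filter, Finset.mem_univ, true_and]; grind
    have hI : (Finset.univ.filter fun k => (if k ∈ S.R then Pauli.I else if k ∈ A then .X
        else if k ∈ B then .Y else .Z) = .I) = S.R := by
      ext k; simp only [Finset.mem_filter, Finset.mem_univ, true_and]; grind
    rw [mem_strings_iff]
    have hsum := sum_letterCount fun k => if k ∈ S.R then Pauli.I else if k ∈ A then .X
        else if k ∈ B then .Y else .Z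
    have hS := S.card_eq
    simp only [letterCount, hI, hX, hY] at hsum
    refine FixedIdSet.ext hI ?_ ?_ ?_
    · simp only [ofString, letterCount, hX, hAc]
    · simp only [ofString, letterCount, hY, hBc]
    · simp only [ofString, letterCount]
      omega
  · intro P hP
    rw [mem_strings_iff] at hP
    subst hP
    ext k
    simp only [ofString, Finset.mem_filter, Finset.mem_univ, true_and]
    cases P k <;> simp
  · rintro ⟨A, B⟩ hp
    simp only [Finset.mem_sigma, Finset.mem_powersetCard] at hp
    obtain ⟨⟨hA, hAc⟩, hB, hBc⟩ := hp
    have hA' : ∀ i ∈ A, i ∉ S.R := fun i hi => Finset.mem_compl.1 (hA hi)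
    have hB' : ∀ i ∈ B, i ∉ S.R ∧ i ∉ A := fun i hi => by
      simpa using hB hi
    simp only [Sigma.mk.injEq, heq_eq_eq]
    constructor
    · ext k; simp only [Finset.mem_filter, Finset.mem_univ, true_and]; grind
    · ext k; simp only [Finset.mem_filter, Finset.mem_univ, true_and]; grind

theorem card_strings_mul (S : FixedIdSet n) :
    S.strings.card * (S.nX ! * S.nY ! * S.nZ !) = (S.nX + S.nY + S.nZ)! := by
  rw [card_strings_eq_choose]
  have h1 := Nat.add_choose_mul_factorial_mul_factorial S.nX (S.nY + S.nZ)
  have h2 := Nat.add_choose_mul_factorial_mul_factorial S.nY S.nZ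
  rw [← Nat.choose_symm_add] at h1 h2
  rw [add_assoc, ← h1, ← h2]
  ring

theorem card_strings_pos (S : FixedIdSet n) : 0 < S.strings.card := by
  refine Nat.pos_of_ne_zero fun h => ?_
  have := S.card_strings_mul
  rw [h, zero_mul] at this
  exact (Nat.factorial_ne_zero _) this.symm

/-- The Hilbert–Schmidt norm of the sum of the strings in `S`. -/
noncomputable def norm (S : FixedIdSet n) : ℝ := Real.sqrt (2 ^ n * (S.strings.card : ℝ))

theorem norm_sq (S : FixedIdSet n) : S.norm ^ 2 = 2 ^ n * S.strings.card :=
  Real.sq_sqrt (by positivity)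

theorem norm_ne_zero (S : FixedIdSet n) : S.norm ≠ 0 := by
  have : (0 : ℝ) < S.strings.card := by exact_mod_cast S.card_strings_pos
  exact (Real.sqrt_pos.2 (by positivity)).ne'

theorem sum_pauliString (S : FixedIdSet n) :
    ∑ P ∈ S.strings, pauliString P = (S.norm : ℂ) • S.B := by
  have h : (S.norm : ℂ) ≠ 0 := by exact_mod_cast S.norm_ne_zero
  rw [B, smul_smul, ← norm, one_div, Complex.ofReal_inv, mul_inv_cancel₀ h, one_smul]

theorem isHermitian_B (S : FixedIdSet n) : S.Bᴴ = S.B := by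
  simp only [B, conjTranspose_smul, conjTranspose_sum, isHermitian_pauliString, Complex.star_def,
    Complex.conj_ofReal]

open Classical in
theorem trace_B_mul (S T : FixedIdSet n) : (S.B * T.B).trace = if S = T then 1 else 0 := by
  have hST : ((∑ P ∈ S.strings, pauliString P) * ∑ Q ∈ T.strings, pauliString Q).trace =
      if S = T then 2 ^ n * (S.strings.card : ℂ) else 0 := by
    simp only [Matrix.sum_mul, Matrix.mul_sum, Matrix.trace_sum, trace_pauliString_mul,
      Finset.sum_ite_eq']
    split_ifs with h
    · subst h
      rw [Finset.sum_ite_mem, Finset.inter_self, Finset.sum_const, nsmul_eq_mul, mul_comm]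
    · refine Finset.sum_eq_zero fun P hP => if_neg fun hP' => h ?_
      rw [← mem_strings_iff.1 hP, ← mem_strings_iff.1 hP']
  have hS : (S.norm : ℂ) ≠ 0 := by exact_mod_cast S.norm_ne_zero
  have hT : (T.norm : ℂ) ≠ 0 := by exact_mod_cast T.norm_ne_zero
  rw [sum_pauliString, sum_pauliString, Matrix.smul_mul, Matrix.mul_smul, Matrix.trace_smul,
    Matrix.trace_smul, smul_eq_mul, smul_eq_mul] at hST
  refine mul_left_cancel₀ hS (mul_left_cancel₀ hT ?_)
  rw [mul_left_comm, hST]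
  split_ifs with h
  · subst h
    rw [mul_one, ← pow_two]
    exact_mod_cast S.norm_sq.symm
  · simp

/-- The coefficient, in the readout of `U^{⊗ n}`, between strings of types `S` and `T`. -/
noncomputable def readoutCoeff (S T : FixedIdSet n) (U : SU2) : ℝ :=
  if S.R = T.R then
    U.bloch .X ^ (S.nX + T.nX) * U.bloch .Y ^ (S.nY + T.nY) * U.bloch .Z ^ (S.nZ + T.nZ) / 2 ^ n
  else 0

theorem integrable_readoutCoeff (S T : FixedIdSet n) :
    Integrable (S.readoutCoeff T) haarSU2 := by
  unfold readoutCoeff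
  split_ifs
  · exact (SU2.integrable_bloch_monomial _ _ _).div_const _
  · exact integrable_zero _ _ _

theorem integral_readoutCoeff (S T : FixedIdSet n) :
    ∫ U, S.readoutCoeff T U ∂haarSU2 = if S.R = T.R then
      SU2.blochMoment (S.nX + T.nX) (S.nY + T.nY) (S.nZ + T.nZ) / 2 ^ n else 0 := by
  unfold readoutCoeff
  split_ifs
  · rw [integral_div]; rfl
  · simp

/-- Averaged over the Haar measure and rescaled to the normalized operators `B_S`, the coefficient
between strings is the coefficient `c_{S,T}`: the factor `√(|S| |T|)` contributes `K!` and the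
square root of the factorials, the moment of the sphere the rest. -/
theorem integral_readoutCoeff_mul_norm (S T : FixedIdSet n) :
    (∫ U, S.readoutCoeff T U ∂haarSU2) * (S.norm * T.norm) = S.coeff T := by
  have hm := SU2.isSphereMoment_blochMoment
  rw [integral_readoutCoeff, coeff]
  by_cases hR : S.R = T.R
  swap
  · rw [if_neg hR, if_neg fun h => hR h.2, zero_mul]
  rw [if_pos hR]
  by_cases hc : S.Compatible T
  swap
  · rw [if_neg hc]
    have : ¬ (Even (S.nX + T.nX) ∧ Even (S.nY + T.nY) ∧ Even (S.nZ + T.nZ)) :=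
      fun h => hc ⟨h, hR⟩
    simp only [not_and_or, Nat.not_even_iff_odd] at this
    rcases this with h | h | h
    · rw [hm.odd_fst h, zero_div, zero_mul]
    · rw [hm.odd_snd _ h, zero_div, zero_mul]
    · rw [hm.odd_thd _ _ h, zero_div, zero_mul]
  rw [if_pos hc]
  obtain ⟨⟨⟨a, ha⟩, ⟨b, hb⟩, ⟨c, hc⟩⟩, -⟩ := hc
  rw [← two_mul] at ha hb hc
  have hS := S.card_eq
  have hT := T.card_eq
  rw [← hR] at hT
  have hwS : S.nX + S.nY + S.nZ = a + b + c := by omega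
  have hwT : T.nX + T.nY + T.nZ = a + b + c := by omega
  have hK : S.halfWeight T = a + b + c := by unfold halfWeight; omega
  have cS : (S.strings.card : ℝ) * (S.nX ! * S.nY ! * S.nZ !) = (a + b + c)! := by
    rw [← hwS]; exact_mod_cast S.card_strings_mul
  have cT : (T.strings.card : ℝ) * (T.nX ! * T.nY ! * T.nZ !) = (a + b + c)! := by
    rw [← hwT]; exact_mod_cast T.card_strings_mul
  -- `√(|S| |T|) = K! / √(n_X! n_Y! n_Z! n'_X! n'_Y! n'_Z!)` with `K = a + b + c`
  have hnorm : S.norm * T.norm = 2 ^ n * ((a + b + c)! * (1 / Real.sqrt ((S.nX ! : ℝ) * S.nY ! *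
      S.nZ ! * T.nX ! * T.nY ! * T.nZ !))) := by
    rw [norm, norm, ← Real.sqrt_mul (by positivity), mul_one_div, eq_comm, ← mul_div_assoc,
      div_eq_iff (by positivity), ← Real.sqrt_mul (by positivity), eq_comm,
      Real.sqrt_eq_iff_mul_self_eq (by positivity) (by positivity)]
    linear_combination (2 ^ n * 2 ^ n * ((a + b + c)! : ℝ)) * cS +
      (2 ^ n * 2 ^ n) * (S.strings.card : ℝ) * (S.nX ! * S.nY ! * S.nZ !) * cT
  rw [hnorm, ha, hb, hc, hm.even_eq, hK, evenSphereMoment, Nat.mul_div_cancel_left a two_pos,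
    Nat.mul_div_cancel_left b two_pos, Nat.mul_div_cancel_left c two_pos]
  have h2 : (2 ^ n : ℝ) ≠ 0 := by positivity
  field_simp

end FixedIdSet

/-! ### The measurement channel in the basis `B_S` -/

theorem readoutCoeff_ofString {n : ℕ} (P Q : Fin n → Pauli) (U : SU2) :
    (if ∀ k, P k = .I ↔ Q k = .I then
      (((∏ k, U.bloch (P k)) * ∏ k, U.bloch (Q k) : ℝ) : ℂ) / 2 ^ n else 0) =
      ((FixedIdSet.ofString P).readoutCoeff (FixedIdSet.ofString Q) U : ℂ) := by
  have hR : (FixedIdSet.ofString P).R = (FixedIdSet.ofString Q).R ↔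
      ∀ k, P k = .I ↔ Q k = .I := by
    simp [FixedIdSet.ofString, Finset.ext_iff]
  rw [FixedIdSet.readoutCoeff]
  simp only [hR, prod_bloch_string]
  split_ifs
  · simp only [FixedIdSet.ofString]
    push_cast
    ring
  · simp

/-- The Haar average of the readout, expanded in Pauli strings. -/
theorem globalSU2Channel_eq_sum_strings (n : ℕ) (A : QubitOp n) :
    globalSU2Channel n A = ∑ P : Fin n → Pauli, ∑ Q : Fin n → Pauli,
      ((∫ U, (FixedIdSet.ofString P).readoutCoeff (FixedIdSet.ofString Q) U ∂haarSU2 : ℝ) : ℂ) •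
        (pauliString Q * A).trace • pauliString P := by
  have hint (P Q : Fin n → Pauli) : Integrable (fun U : SU2 =>
      ((FixedIdSet.ofString P).readoutCoeff (FixedIdSet.ofString Q) U : ℂ)) haarSU2 :=
    (FixedIdSet.integrable_readoutCoeff _ _).ofReal
  ext i j
  simp only [globalSU2Channel, measurementChannel, of_apply, readout_globalRotation,
    readoutCoeff_ofString, Matrix.sum_apply, Matrix.smul_apply, smul_eq_mul]
  rw [integral_finsetSum _ fun P _ => integrable_finsetSum _ fun Q _ => (hint P Q).mul_const _]
  refine Finset.sum_congr rfl fun P _ => ?_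
  rw [integral_finsetSum _ fun Q _ => (hint P Q).mul_const _]
  refine Finset.sum_congr rfl fun Q _ => ?_
  rw [integral_mul_const, integral_complex_ofReal]

theorem globalSU2Channel_eq_sum_B (n : ℕ) (A : QubitOp n) :
    globalSU2Channel n A = ∑ S : FixedIdSet n, ∑ T : FixedIdSet n,
      ((S.coeff T : ℂ) * (T.B * A).trace) • S.B := by
  rw [globalSU2Channel_eq_sum_strings, FixedIdSet.sum_strings]
  refine Finset.sum_congr rfl fun S _ => ?_
  have h (P) (hP : P ∈ S.strings) := FixedIdSet.sum_strings fun Q : Fin n → Pauli =>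
    ((∫ U, (FixedIdSet.ofString P).readoutCoeff (FixedIdSet.ofString Q) U ∂haarSU2 : ℝ) : ℂ) •
        (pauliString Q * A).trace • pauliString P
  rw [Finset.sum_congr rfl h, Finset.sum_comm]
  refine Finset.sum_congr rfl fun T _ => ?_
  have h' (P) (hP : P ∈ S.strings) :
      ∑ Q ∈ T.strings, ((∫ U, (FixedIdSet.ofString P).readoutCoeff (FixedIdSet.ofString Q) U
        ∂haarSU2 : ℝ) : ℂ) • (pauliString Q * A).trace • pauliString P =
      ((∫ U, S.readoutCoeff T U ∂haarSU2 : ℝ) : ℂ) •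
        ((∑ Q ∈ T.strings, pauliString Q) * A).trace • pauliString P := by
    rw [Matrix.sum_mul, Matrix.trace_sum, Finset.sum_smul, Finset.smul_sum]
    refine Finset.sum_congr rfl fun Q hQ => ?_
    rw [FixedIdSet.mem_strings_iff.1 hP, FixedIdSet.mem_strings_iff.1 hQ]
  rw [Finset.sum_congr rfl h', ← Finset.smul_sum, ← Finset.smul_sum, S.sum_pauliString,
    T.sum_pauliString, ← FixedIdSet.integral_readoutCoeff_mul_norm, Matrix.smul_mul,
    Matrix.trace_smul, smul_smul, smul_smul]
  push_cast
  rw [smul_eq_mul]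
  congr 1
  ring

theorem trace_B_mul_globalSU2Channel {n : ℕ} (S T : FixedIdSet n) :
    ((S.B)ᴴ * globalSU2Channel n T.B).trace = (S.coeff T : ℂ) := by
  classical
  rw [globalSU2Channel_eq_sum_B, S.isHermitian_B]
  simp only [Matrix.mul_sum, Matrix.trace_sum, Matrix.mul_smul, Matrix.trace_smul,
    FixedIdSet.trace_B_mul, smul_eq_mul]
  simp

theorem mainTheorem4 (n : ℕ) :
    (∀ ρ : QubitOp n, globalSU2Channel n ρ =
      ∑ S : FixedIdSet n, ∑ S' : FixedIdSet n,
        ((S.coeff S' : ℂ) * (S'.B * ρ).trace) • S.B) ∧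
    (∀ S S' : FixedIdSet n,
      ((S.B)ᴴ * globalSU2Channel n S'.B).trace = (S.coeff S' : ℂ)) ∧
    (∀ S S' : FixedIdSet n,
      (S.R ≠ S'.R ∨ Odd (S.nX + S'.nX) ∨ Odd (S.nY + S'.nY) ∨ Odd (S.nZ + S'.nZ)) →
        ((S.B)ᴴ * globalSU2Channel n S'.B).trace = 0) := by
  refine ⟨globalSU2Channel_eq_sum_B n, trace_B_mul_globalSU2Channel, fun S S' h => ?_⟩
  rw [trace_B_mul_globalSU2Channel, FixedIdSet.coeff, if_neg, Complex.ofReal_zero]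
  rintro ⟨⟨hX, hY, hZ⟩, hR⟩
  simp only [← Nat.not_even_iff_odd] at h
  tauto
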